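/- Model. There are $n$ parties in a synchronous network with authenticated point-to-point links: a message sent at the beginning of a round is received at its end. Signatures are ideal, under a public-key infrastructure and no further (trusted) setup: every party can sign bit strings in its own name and check signatures of all parties, signatures of uncorrupted parties cannot be forged, and one signature is $\kappa$ bits long. A protocol is deterministic. An adaptive Byzantine adversary sees all messages and may corrupt parties at any time during the execution; corrupted parties behave arbitrarily, and a party is honest if it is never corrupted. A protocol solves Byzantine agreement with at most $f$ faults if, in every execution in which at most $f$ parties are corrupted in total, (consistency) any two honest parties that decide, decide the same value; (termination) every honest party decides a value and terminates; (validity) if all honest parties have the same input value, then all honest parties decide that value. Its communication complexity is the maximum, over all these executions, of the total number of bits (including $\kappa$ bits for each signature) sent by parties that are not corrupted at the time of sending. Theorem. For every constant $\varepsilon>0$ and every constant $c\in\mathbb{N}$ there is a constant $C$ such that for all $n$ and all $\kappa\ge 1$ there is a protocol for $n$ parties, whose input and output values are bit strings of length at most $c\kappa$, that for every natural number $f\le(\tfrac12-\varepsilon)n$ solves Byzantine agreement with at most $f$ adaptive Byzantine faults and has communication complexity at most $C\kappa n^2$. -/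

import Mathlib

open scoped BigOperators

namespace ByzantineAgreement

/-- An ideal digital signature: the signature of party `signer` on the bit string `content`.
The public-key infrastructure is that everybody can check a signature against the name of a party;
there is no further setup. -/
@[ext]
structure Sig (n : ℕ) where
  signer : Fin n
  content : List Bool

instance (n : ℕ) : DecidableEq (Sig n) := fun a b =>
  decidable_of_iff (a.signer = b.signer ∧ a.content = b.content) Sig.ext_iff.symm

/-- A message consists of plain bits and of attached signatures. A signature is a string of `κ`
bits which by itself shows neither who issued it nor what was signed. -/
structure Message (n : ℕ) where
  payload : List Bool
  sigs : List (Sig n)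

/-- The empty message, which is the same as sending nothing. -/
def Message.silent {n : ℕ} : Message n := ⟨[], []⟩

/-- The number of bits of a message when a signature has `κ` bits. -/
def Message.bits {n : ℕ} (κ : ℕ) (m : Message n) : ℕ :=
  m.payload.length + κ * m.sigs.length

/-- What the recipient of a message learns from it: the plain bits, and, for every attached
signature, whether it is the signature that the recipient checks it against (`some s` if it is
the signature `s`, and `none` if the check fails). -/
structure View (n : ℕ) where
  payload : List Bool
  checked : List (Option (Sig n))

/-- The `i`-th attached signature is checked against the `i`-th expected one, and is thrown away
if the check fails. In particular a signature carries no information beyond its validity. -/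
def Message.view {n : ℕ} (m : Message n) (expected : List (Sig n)) : View n where
  payload := m.payload
  checked := List.zipWith (fun s e => if s = e then some e else none) m.sigs expected

/-- What a party receives in one round, indexed by the senders. -/
abbrev Inbox (n : ℕ) : Type := Fin n → View n

/-- Values are bit strings of length at most `ℓ`. -/
abbrev Value (ℓ : ℕ) : Type := {x : List Bool // x.length ≤ ℓ}

/-- A deterministic synchronous protocol for `n` parties with values of at most `ℓ` bits.
The behaviour of a party is a function of its name, its input, and the list of its inboxes of all
the previous rounds (latest round first). -/
structure Protocol (n ℓ : ℕ) where
  /-- `expect p x h q b`: the signatures against which `p` checks, in order, the signatures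
  attached to a message of the current round with sender `q` and payload `b`. -/
  expect : Fin n → Value ℓ → List (Inbox n) → Fin n → List Bool → List (Sig n)
  /-- `send p x h q`: the message that `p` sends to `q` in the current round. -/
  send : Fin n → Value ℓ → List (Inbox n) → Fin n → Message n
  /-- `decide p x h`: the value that `p` has decided, if any. -/
  decide : Fin n → Value ℓ → List (Inbox n) → Option (Value ℓ)
  /-- A party sends only its own signatures and signatures that it has received. -/
  sigs_known : ∀ p x h q s, s ∈ (send p x h q).sigs →
    s.signer = p ∨ ∃ box ∈ h, ∃ r, some s ∈ (box r).checked
  /-- A decision is final. -/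
  decide_final : ∀ p x h box v, decide p x h = some v → decide p x (box :: h) = some v
  /-- A party that has decided has terminated: it sends nothing any more. -/
  send_of_decided : ∀ p x h q, decide p x h ≠ none → send p x h q = Message.silent

variable {n ℓ : ℕ}

/-- The local history of party `p` at the beginning of each round, if the inputs are `x` and
`sent t q p` is the message that `q` sends to `p` in round `t`. All messages are delivered at
the end of the round in which they are sent. -/
def Protocol.history (P : Protocol n ℓ) (x : Fin n → Value ℓ)
    (sent : ℕ → Fin n → Fin n → Message n) (p : Fin n) : ℕ → List (Inbox n)
  | 0 => []
  | t + 1 =>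
    (fun q => (sent t q p).view
      (P.expect p (x p) (Protocol.history P x sent p t) q (sent t q p).payload)) ::
        Protocol.history P x sent p t

/-- An execution of a protocol against an adaptive Byzantine adversary, which sees all messages,
can corrupt a party at any time (in round `t` even after it has seen the messages of round `t`),
and speaks for a party as soon as it is corrupted. -/
structure Execution (P : Protocol n ℓ) where
  /-- the inputs of the parties -/
  input : Fin n → Value ℓ
  /-- `corrupt t`: the parties that are corrupted by the time the messages of round `t` are sent -/
  corrupt : ℕ → Finset (Fin n)
  /-- `sent t p q`: the message that `p` sends to `q` in round `t` -/
  sent : ℕ → Fin n → Fin n → Message n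
  /-- A corrupted party remains corrupted. -/
  corrupt_mono : Monotone corrupt
  /-- A party that is not corrupted follows the protocol. -/
  follows : ∀ t p, p ∉ corrupt t → ∀ q,
    sent t p q = P.send p (input p) (P.history input sent p t) q
  /-- Signatures are unforgeable: a corrupted party sends only signatures of corrupted parties
  and signatures that an uncorrupted party has sent, to whomever, in this round or before. -/
  unforgeable : ∀ t p, p ∈ corrupt t → ∀ q, ∀ s ∈ (sent t p q).sigs,
    s.signer ∈ corrupt t ∨
      ∃ t' ≤ t, ∃ p', p' ∉ corrupt t' ∧ ∃ q', s ∈ (sent t' p' q').sigs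

namespace Execution

variable {P : Protocol n ℓ}

/-- A party is honest if it is not corrupted throughout the execution. -/
def Honest (e : Execution P) (p : Fin n) : Prop := ∀ t, p ∉ e.corrupt t

/-- At most `f` parties are corrupted in the whole execution. -/
def AtMostFaulty (e : Execution P) (f : ℕ) : Prop := ∀ t, (e.corrupt t).card ≤ f

/-- Party `p` decides the value `v` (and terminates) in some round. -/
def Decides (e : Execution P) (p : Fin n) (v : Value ℓ) : Prop :=
  ∃ t, P.decide p (e.input p) (P.history e.input e.sent p t) = some v

/-- Any two honest parties that decide, decide the same value. -/
def Consistency (e : Execution P) : Prop :=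
  ∀ p q v w, e.Honest p → e.Honest q → e.Decides p v → e.Decides q w → v = w

/-- Every honest party decides a value and terminates. -/
def Termination (e : Execution P) : Prop :=
  ∀ p, e.Honest p → ∃ v, e.Decides p v

/-- If all honest parties have the same input, then all of them decide that value. -/
def Validity (e : Execution P) : Prop :=
  ∀ v, (∀ p, e.Honest p → e.input p = v) → ∀ p, e.Honest p → e.Decides p v

/-- The number of bits sent in the first `T` rounds by parties that are not corrupted when they
send them, when a signature has `κ` bits. -/
def bitsSent (e : Execution P) (κ T : ℕ) : ℕ :=
  ∑ t ∈ Finset.range T, ∑ p ∈ (e.corrupt t)ᶜ, ∑ q, (e.sent t p q).bits κ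

end Execution

/-- `P` solves Byzantine agreement in the presence of at most `f` adaptive Byzantine faults. -/
def Protocol.SolvesBA (P : Protocol n ℓ) (f : ℕ) : Prop :=
  ∀ e : Execution P, e.AtMostFaulty f → e.Consistency ∧ e.Termination ∧ e.Validity

/-- In every execution with at most `f` faults, at most `B` bits are sent by uncorrupted
parties altogether, when a signature has `κ` bits. -/
def Protocol.CommunicationLE (P : Protocol n ℓ) (f κ : ℕ) (B : ℝ) : Prop :=
  ∀ e : Execution P, e.AtMostFaulty f → ∀ T, (e.bitsSent κ T : ℝ) ≤ B

end ByzantineAgreement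

/-! The protocol works by recursive halving. In a phase, a block of parties runs graded consensus,
one half of the block then reaches agreement recursively and announces its result to the whole
block, and the parties without a grade adopt what the majority of that half announces. A second
phase does the same with the other half. If the fraction `1 / 2 + ε` of a block is honest, the same
holds for one of its halves. The phase of that half creates agreement. No phase destroys agreement,
however corrupt its half is, because unanimous inputs give every honest party a grade and a graded
party ignores the half (`phase_spec`, `agree_spec`).

The difficulty is the price of graded consensus. A certificate consists of about `|S|` signatures,
so sending it to all of `S` would cost about `κ * |S| ^ 2` bits per party. It is sent instead along
an expander of constant degree (`exists_isExpander`). If `ε * |S|` honest parties hold a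
certificate, then all but fewer than `ε * |S|` honest parties learn of it (`certify_spec`). The
surplus `ε` in the honest majority makes up for those who do not, so graded consensus still works
(`graded_spec`). A party thus pays `O(κ * |S|)` per phase besides the recursion, and it recurses
into one half only. The geometric sum over its blocks is `O(κ * n)` per party (`costLE_agree`). -/

open scoped BigOperators

namespace ByzantineAgreement

/-! ### Round-by-round programs, their cost, and unforgeability of stamped signatures. -/

section Programs

/-- A program of a single party: it either has returned a result, or takes part in one more round
and continues depending on what it receives. -/
inductive Program (n : ℕ) (α : Type) : Type
  | pure (a : α) : Program n α
  | round (send : Fin n → Message n) (expect : Fin n → List Bool → List (Sig n))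
      (next : Inbox n → Program n α) : Program n α

namespace Program

variable {n ℓ : ℕ} {α β γ : Type}

/-- Sequential composition. -/
def bind : Program n α → (α → Program n β) → Program n β
  | pure a, f => f a
  | round s x k, f => round s x fun i => (k i).bind f

theorem bind_assoc (A : Program n α) (f : α → Program n β) (g : β → Program n γ) :
    (A.bind f).bind g = A.bind fun a => (f a).bind g := by
  induction A with
  | pure a => rfl
  | round s x k ih => simp only [bind, ih]

/-- What is left of a program after one round. -/
def next : Program n α → Inbox n → Program n α
  | pure a, _ => pure a
  | round _ _ k, i => k i

/-- What is left of a program after the rounds of a history (latest round first). -/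
def after (A : Program n α) : List (Inbox n) → Program n α
  | [] => A
  | i :: h => (A.after h).next i

/-- The messages of the current round. -/
def outgoing : Program n α → Fin n → Message n
  | pure _, _ => Message.silent
  | round s _ _, q => s q

/-- The signatures expected in the current round. -/
def expected : Program n α → Fin n → List Bool → List (Sig n)
  | pure _, _, _ => []
  | round _ x _, q, b => x q b

/-- The result, if the program has returned. -/
def result : Program n α → Option α
  | pure a => some a
  | round _ _ _ => none

/-- The program takes exactly `r` rounds. -/
inductive HasLength : Program n α → ℕ → Prop
  | pure (a : α) : HasLength (pure a) 0
  | round {s x k r} (h : ∀ i, HasLength (k i) r) : HasLength (round s x k) (r + 1)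

theorem HasLength.bind {A : Program n α} {r : ℕ} (hA : A.HasLength r) {f : α → Program n β}
    {r' : ℕ} (hf : ∀ a, (f a).HasLength r') : (A.bind f).HasLength (r + r') := by
  induction hA with
  | pure a => simpa [Program.bind] using hf a
  | round h ih => rw [Nat.add_right_comm]; exact HasLength.round ih

/-- Doing nothing for `r` rounds. -/
def idle (a : α) : ℕ → Program n α
  | 0 => pure a
  | r + 1 => round (fun _ => Message.silent) (fun _ _ => []) fun _ => idle a r

theorem hasLength_idle (a : α) (r : ℕ) : (idle a r : Program n α).HasLength r := by
  induction r with
  | zero => exact .pure a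
  | succ r ih => exact .round fun _ => ih

/-- The program sends at most `B` bits. -/
def CostLE (κ : ℕ) : Program n α → ℕ → Prop
  | pure _, _ => True
  | round s _ k, B => ∃ B', ∑ q, (s q).bits κ + B' ≤ B ∧ ∀ i, CostLE κ (k i) B'

theorem costLE_pure (κ : ℕ) (a : α) : (pure a : Program n α).CostLE κ 0 := trivial

theorem CostLE.mono {κ : ℕ} {A : Program n α} {B B' : ℕ} (h : A.CostLE κ B) (hB : B ≤ B') :
    A.CostLE κ B' := by
  cases A with
  | pure a => trivial
  | round s x k => obtain ⟨b, hb, hk⟩ := h; exact ⟨b, hb.trans hB, hk⟩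

theorem CostLE.bind {κ : ℕ} {A : Program n α} {B B' : ℕ} (h : A.CostLE κ B)
    {f : α → Program n β} (hf : ∀ a, (f a).CostLE κ B') : (A.bind f).CostLE κ (B + B') := by
  induction A generalizing B with
  | pure a => exact (hf a).mono (by omega)
  | round s x k ih =>
    obtain ⟨b, hb, hk⟩ := h
    exact ⟨b + B', by omega, fun i => ih i (hk i)⟩

theorem costLE_idle (κ : ℕ) (a : α) (r : ℕ) : (idle a r : Program n α).CostLE κ 0 := by
  induction r with
  | zero => trivial
  | succ r ih => exact ⟨0, by simp [Message.bits, Message.silent], fun _ => ih⟩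

theorem CostLE.next {κ : ℕ} {A : Program n α} {B : ℕ} (h : A.CostLE κ B) :
    ∃ B', ∑ q, (A.outgoing q).bits κ + B' ≤ B ∧ ∀ i, (A.next i).CostLE κ B' := by
  cases A with
  | pure a => exact ⟨0, by simp [outgoing, Message.bits, Message.silent], fun _ => trivial⟩
  | round s x k => exact h

end Program

variable {n ℓ : ℕ} {α : Type}

/-- The content to be signed for the value `v` in round `t`. -/
def stamp (t : ℕ) (v : List Bool) : List Bool := List.replicate t true ++ false :: v

/-- The unary round number ends at the first `false`, so the code is self-delimiting. Its length
costs nothing, as a signature is charged `κ` bits whatever it signs. -/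
theorem stamp_inj {t t' : ℕ} {v v' : List Bool} (h : stamp t v = stamp t' v') :
    t = t' ∧ v = v' := by
  induction t generalizing t' with
  | zero => cases t' <;> simp_all [stamp, List.replicate_succ]
  | succ t ih =>
    cases t' with
    | zero => simp [stamp, List.replicate_succ] at h
    | succ t' =>
      have := @ih t' (by simpa [stamp, List.replicate_succ] using h)
      exact ⟨by omega, this.2⟩

/-- Keeps dummy signatures, which sign the empty string, apart from votes. -/
theorem stamp_ne_nil (t : ℕ) (v : List Bool) : stamp t v ≠ [] := by simp [stamp]

/-- Party `p` with history `h` may attach its own signature on the empty string or on something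
stamped with the current round, and signatures that it has received. -/
def MayAttach (p : Fin n) (h : List (Inbox n)) (s : Sig n) : Prop :=
  (s.signer = p ∧ (s.content = [] ∨ ∃ v, s.content = stamp h.length v)) ∨
    ∃ box ∈ h, ∃ r, some s ∈ (box r).checked

open Classical in
/-- The message without the signatures that must not be attached. -/
noncomputable def Message.restrict (m : Message n) (p : Fin n) (h : List (Inbox n)) : Message n :=
  ⟨m.payload, m.sigs.filter fun s => MayAttach p h s⟩

theorem Message.restrict_eq_self {m : Message n} {p : Fin n} {h : List (Inbox n)}
    (hm : ∀ s ∈ m.sigs, MayAttach p h s) : m.restrict p h = m := by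
  cases m
  simp only [Message.restrict, Message.mk.injEq, true_and]
  exact List.filter_eq_self.2 fun s hs => by simpa using hm s hs

theorem Message.bits_restrict_le (κ : ℕ) (m : Message n) (p : Fin n) (h : List (Inbox n)) :
    (m.restrict p h).bits κ ≤ m.bits κ := by
  unfold Message.bits Message.restrict
  exact Nat.add_le_add_left (Nat.mul_le_mul_left _ (List.length_filter_le _ _)) _

theorem Message.mayAttach_of_mem_restrict {m : Message n} {p : Fin n} {h : List (Inbox n)}
    {s : Sig n} (hs : s ∈ (m.restrict p h).sigs) : MayAttach p h s :=
  (by simpa [Message.restrict] using hs : s ∈ m.sigs ∧ MayAttach p h s).2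

theorem Message.mem_sigs_of_mem_view {m : Message n} {l : List (Sig n)} {s : Sig n}
    (h : some s ∈ (m.view l).checked) : s ∈ m.sigs := by
  rcases m with ⟨b, sigs⟩
  simp only [Message.view] at h ⊢
  induction sigs generalizing l with
  | nil => simp at h
  | cons a sigs ih =>
    cases l with
    | nil => simp at h
    | cons c l =>
      simp only [List.zipWith_cons_cons, List.mem_cons] at h
      rcases h with h | h
      · split_ifs at h with hac
        cases h
        exact List.mem_cons.2 (Or.inl hac.symm)
      · exact List.mem_cons_of_mem _ (ih h)

/-- The protocol in which every party executes its program. -/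
noncomputable def Program.toProtocol (A : Fin n → Value ℓ → Program n (Value ℓ)) :
    Protocol n ℓ where
  expect p x h := ((A p x).after h).expected
  -- The filter makes `sigs_known` true for arbitrary programs. For the honest parties of the actual
  -- protocol it is shown later to remove nothing.
  send p x h q := (((A p x).after h).outgoing q).restrict p h
  decide p x h := ((A p x).after h).result
  sigs_known p x h q s hs := by
    rcases Message.mayAttach_of_mem_restrict hs with h | h
    · exact Or.inl h.1
    · exact Or.inr h
  decide_final p x h box v hv := by
    change ((A p x).after h).result = some v at hv
    change (((A p x).after h).next box).result = some v
    cases hA : (A p x).after h with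
    | pure a => rwa [hA] at hv
    | round s y k => simp [hA, Program.result] at hv
  send_of_decided p x h q hd := by
    cases hA : (A p x).after h with
    | pure a => simp [Program.outgoing, Message.restrict, Message.silent]
    | round s y k => simp [hA, Program.result] at hd

namespace Execution

variable {A : Fin n → Value ℓ → Program n (Value ℓ)} (e : Execution (Program.toProtocol A))

/-- The history of a party at the beginning of round `t`. -/
noncomputable def hist (p : Fin n) (t : ℕ) : List (Inbox n) :=
  (Program.toProtocol A).history e.input e.sent p t

/-- The rest of the program of a party at the beginning of round `t`. -/
noncomputable def residual (p : Fin n) (t : ℕ) : Program n (Value ℓ) :=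
  (A p (e.input p)).after (e.hist p t)

/-- What a party receives in round `t`. -/
noncomputable def inbox (p : Fin n) (t : ℕ) : Inbox n := fun q =>
  (e.sent t q p).view ((e.residual p t).expected q (e.sent t q p).payload)

theorem hist_succ (p : Fin n) (t : ℕ) : e.hist p (t + 1) = e.inbox p t :: e.hist p t := rfl

theorem length_hist (p : Fin n) (t : ℕ) : (e.hist p t).length = t := by
  induction t with
  | zero => rfl
  | succ t ih => rw [hist_succ, List.length_cons, ih]

theorem mem_hist {p : Fin n} {t : ℕ} {i : Inbox n} :
    i ∈ e.hist p t ↔ ∃ t' < t, i = e.inbox p t' := by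
  induction t with
  | zero => simp [hist, Protocol.history]
  | succ t ih =>
    rw [hist_succ, List.mem_cons, ih]
    constructor
    · rintro (h | ⟨t', h, h'⟩)
      · exact ⟨t, by omega, h⟩
      · exact ⟨t', by omega, h'⟩
    · rintro ⟨t', h, h'⟩
      rcases Nat.lt_succ_iff_lt_or_eq.1 h with h | rfl
      · exact Or.inr ⟨t', h, h'⟩
      · exact Or.inl h'

theorem residual_succ (p : Fin n) (t : ℕ) :
    e.residual p (t + 1) = (e.residual p t).next (e.inbox p t) := rfl

theorem sent_eq {t : ℕ} {p : Fin n} (hp : p ∉ e.corrupt t) (q : Fin n) :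
    e.sent t p q = ((e.residual p t).outgoing q).restrict p (e.hist p t) :=
  e.follows t p hp q

theorem sent_eq_of_mayAttach {t : ℕ} {p : Fin n} (hp : e.Honest p) (q : Fin n)
    (h : ∀ s ∈ ((e.residual p t).outgoing q).sigs, MayAttach p (e.hist p t) s) :
    e.sent t p q = (e.residual p t).outgoing q := by
  rw [e.sent_eq (hp t), Message.restrict_eq_self h]

/-- Keeps honest parties in step even when a subprogram gives no guarantee, as in a block with too
many corrupted members. -/
theorem residual_bind_of_hasLength {p : Fin n} {B : Program n α} {r : ℕ} (hB : B.HasLength r)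
    {t : ℕ} {k : α → Program n (Value ℓ)} (h : e.residual p t = B.bind k) :
    ∃ a, e.residual p (t + r) = k a := by
  induction hB generalizing t with
  | pure a => exact ⟨a, h⟩
  | round hk ih =>
    obtain ⟨a, ha⟩ := ih (e.inbox p t) (t := t + 1) (by rw [residual_succ, h]; rfl)
    exact ⟨a, by rw [← ha]; congr 1; omega⟩

/-- Whenever somebody sends a stamped signature of an honest party, that party itself has sent it
in the round of the stamp. -/
theorem signer_sent {q : Fin n} (hq : e.Honest q) {τ : ℕ} {v : List Bool} {t : ℕ} {p r : Fin n}
    (h : (⟨q, stamp τ v⟩ : Sig n) ∈ (e.sent t p r).sigs) :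
    ∃ r', (⟨q, stamp τ v⟩ : Sig n) ∈ (e.sent τ q r').sigs := by
  induction t using Nat.strong_induction_on generalizing p r with
  | _ t ih =>
    -- The case of an uncorrupted sender is separate because a corrupted one may replay a signature
    -- sent in the same round, which the induction hypothesis does not cover.
    have key : ∀ p r, p ∉ e.corrupt t → (⟨q, stamp τ v⟩ : Sig n) ∈ (e.sent t p r).sigs →
        ∃ r', (⟨q, stamp τ v⟩ : Sig n) ∈ (e.sent τ q r').sigs := by
      intro p r hp h
      have h' := h
      rw [e.sent_eq hp] at h'
      rcases Message.mayAttach_of_mem_restrict h' with ⟨h1, h2⟩ | ⟨box, hb, r', hr⟩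
      · simp only at h1 h2
        subst h1
        rcases h2 with h2 | ⟨w, hw⟩
        · exact absurd h2 (stamp_ne_nil _ _)
        · rw [e.length_hist] at hw
          obtain rfl := (stamp_inj hw).1
          exact ⟨r, h⟩
      · obtain ⟨t', ht', rfl⟩ := e.mem_hist.1 hb
        exact ih t' ht' (Message.mem_sigs_of_mem_view hr)
    by_cases hp : p ∈ e.corrupt t
    · rcases e.unforgeable t p hp r _ h with h | ⟨t', ht', p', hp', q', h'⟩
      · exact absurd h (hq t)
      · rcases ht'.lt_or_eq with hlt | rfl
        · exact ih t' hlt h'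
        · exact key p' q' hp' h'
    · exact key p r hp h

/-- The count runs over the programs of all parties, corrupted ones included, on whatever they
receive. In the induction, `B'` is the budget left after `T` rounds. -/
theorem bitsSent_le {κ : ℕ} {B : Fin n → ℕ} (hB : ∀ p x, (A p x).CostLE κ (B p)) (T : ℕ) :
    e.bitsSent κ T ≤ ∑ p, B p := by
  have key : ∀ p, ∃ B', ∑ t ∈ Finset.range T, ∑ q, ((e.residual p t).outgoing q).bits κ + B' ≤ B p
      ∧ (e.residual p T).CostLE κ B' := by
    intro p
    induction T with
    | zero => exact ⟨B p, by simp, hB p _⟩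
    | succ T ih =>
      obtain ⟨b, hb, hc⟩ := ih
      obtain ⟨b', hb', hc'⟩ := hc.next
      exact ⟨b', by rw [Finset.sum_range_succ]; omega, hc' _⟩
  calc e.bitsSent κ T
      ≤ ∑ t ∈ Finset.range T, ∑ p, ∑ q, ((e.residual p t).outgoing q).bits κ := by
        refine Finset.sum_le_sum fun t _ => ?_
        refine le_trans (Finset.sum_le_sum fun p hp => Finset.sum_le_sum fun q _ => ?_)
          (Finset.sum_le_sum_of_subset (Finset.subset_univ (e.corrupt t)ᶜ))
        rw [e.sent_eq (Finset.mem_compl.1 hp)]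
        exact Message.bits_restrict_le _ _ _ _
    _ = ∑ p, ∑ t ∈ Finset.range T, ∑ q, ((e.residual p t).outgoing q).bits κ :=
        Finset.sum_comm
    _ ≤ ∑ p, B p := Finset.sum_le_sum fun p _ => by
        obtain ⟨b, hb, -⟩ := key p
        omega

end Execution

end Programs

/-! ### Expanders of constant degree, by counting. -/

section Expanders

/-- Out-neighbourhoods of bounded size such that there is an edge between any two sets that
contain at least the fraction `ε` of the vertices. -/
theorem exists_expander_type {ε : ℝ} (hε : 0 < ε) (hε1 : ε < 1) :
    ∃ d : ℕ, ∀ (V : Type) [Fintype V] [DecidableEq V] [Nonempty V], ∃ g : V × Fin d → V,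
      ∀ X Y : Finset V, ε * Fintype.card V ≤ X.card → ε * Fintype.card V ≤ Y.card →
        ∃ a ∈ X, ∃ i, g (a, i) ∈ Y := by
  -- For `|X|, |Y| ≥ ε * m`, a random map has no edge from `X` to `Y` with probability at most `((1
  -- - ε) ^ d) ^ (ε * m)`. The choices `j * ε ≥ 3` and `(1 - ε) ^ d < 2 ^ (-j)` push this below `8 ^
  -- (-m)`, which beats the at most `4 ^ m` pairs.
  obtain ⟨j, hj⟩ := exists_nat_gt (3 / ε)
  have hj : 3 ≤ j * ε := by rw [div_lt_iff₀ hε] at hj; exact hj.le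
  obtain ⟨d, hd⟩ := exists_pow_lt_of_lt_one (show (0 : ℝ) < (1 / 2) ^ j by positivity)
    (show 1 - ε < 1 by linarith)
  refine ⟨d, fun V _ _ _ => ?_⟩
  set m := Fintype.card V with hm
  have hm0 : 0 < m := Fintype.card_pos
  have hmR : (0 : ℝ) < m := by exact_mod_cast hm0
  by_contra! hcon
  let bad (X Y : Finset V) : Finset (V × Fin d → V) :=
    Fintype.piFinset fun ai => if ai.1 ∈ X then Yᶜ else Finset.univ
  let pairs : Finset (Finset V × Finset V) :=
    Finset.univ.filter fun Z => ε * m ≤ Z.1.card ∧ ε * m ≤ Z.2.card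
  have hcover : (Finset.univ : Finset (V × Fin d → V)) ⊆ pairs.biUnion fun Z => bad Z.1 Z.2 := by
    intro g _
    obtain ⟨X, Y, hX, hY, h⟩ := hcon g
    refine Finset.mem_biUnion.2 ⟨(X, Y), by simp [pairs, hX, hY], ?_⟩
    refine Fintype.mem_piFinset.2 fun ai => ?_
    split_ifs with hai
    · exact Finset.mem_compl.2 (h _ hai ai.2)
    · exact Finset.mem_univ _
  have hbad : ∀ Z ∈ pairs, ((bad Z.1 Z.2).card : ℝ) ≤ (m : ℝ) ^ (m * d) * (1 / 8) ^ m := by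
    rintro ⟨X, Y⟩ hZ
    obtain ⟨hX, hY⟩ : ε * m ≤ X.card ∧ ε * m ≤ Y.card := by simpa [pairs] using hZ
    have hcard : (bad X Y).card = ((m - Y.card) ^ X.card * m ^ (m - X.card)) ^ d := by
      have hite : ∀ ai : V × Fin d, (if ai.1 ∈ X then Yᶜ else Finset.univ).card =
          if ai.1 ∈ X then m - Y.card else m := fun ai => by
        split_ifs <;> simp [Finset.card_compl, hm]
      simp only [bad, Fintype.card_piFinset, hite]
      have hprod : ∏ x : V, (if x ∈ X then m - Y.card else m) =
          (m - Y.card) ^ X.card * m ^ (m - X.card) := by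
        rw [Finset.prod_ite]
        simp [Finset.filter_not, ← Finset.compl_eq_univ_sdiff, Finset.card_compl, hm]
      rw [Fintype.prod_prod_type_right]
      exact (Finset.prod_congr rfl fun _ _ => hprod).trans (by simp)
    have hYm : Y.card ≤ m := Finset.card_le_univ Y
    have hXm : X.card ≤ m := Finset.card_le_univ X
    rw [hcard]
    push_cast [Nat.cast_sub hYm]
    have h1 : ((m : ℝ) - Y.card) ≤ (1 - ε) * m := by linarith
    have h0 : (0 : ℝ) ≤ (m : ℝ) - Y.card := by
      rw [sub_nonneg]; exact_mod_cast hYm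
    calc (((m : ℝ) - Y.card) ^ X.card * (m : ℝ) ^ (m - X.card)) ^ d
        ≤ (((1 - ε) * m) ^ X.card * (m : ℝ) ^ (m - X.card)) ^ d := by gcongr
      _ = (m : ℝ) ^ (m * d) * ((1 - ε) ^ d) ^ X.card := by
        rw [mul_pow (1 - ε), mul_assoc, ← pow_add, Nat.add_sub_cancel' hXm, mul_pow, ← pow_mul,
          ← pow_mul, ← pow_mul, mul_comm, mul_comm d]
      _ ≤ (m : ℝ) ^ (m * d) * ((1 / 2) ^ j) ^ X.card := by
        have : (0 : ℝ) ≤ 1 - ε := by linarith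
        gcongr
      _ ≤ (m : ℝ) ^ (m * d) * (1 / 8) ^ m := by
        have h8 : (1 / 8 : ℝ) ^ m = (1 / 2) ^ (3 * m) := by rw [pow_mul]; norm_num
        have hjX : 3 * m ≤ j * X.card := by
          have : (3 * m : ℝ) ≤ j * X.card := by nlinarith [Nat.cast_nonneg (α := ℝ) j]
          exact_mod_cast this
        rw [h8, ← pow_mul]
        gcongr ?_ * ?_
        exact pow_le_pow_of_le_one (by norm_num) (by norm_num) hjX
  have hpairs : (pairs.card : ℝ) ≤ 4 ^ m := by
    have : pairs.card ≤ 2 ^ m * 2 ^ m := by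
      simpa [hm] using Finset.card_le_univ pairs
    have h4 : (4 : ℝ) ^ m = 2 ^ m * 2 ^ m := by rw [← mul_pow]; norm_num
    rw [h4]; exact_mod_cast this
  have htotal : ((m : ℝ) ^ (m * d)) ≤ 4 ^ m * ((m : ℝ) ^ (m * d) * (1 / 8) ^ m) := by
    calc ((m : ℝ) ^ (m * d)) = ((Finset.univ : Finset (V × Fin d → V)).card : ℝ) := by
          simp [hm]
      _ ≤ ((pairs.biUnion fun Z => bad Z.1 Z.2).card : ℝ) := by
          exact_mod_cast Finset.card_le_card hcover
      _ ≤ ∑ Z ∈ pairs, ((bad Z.1 Z.2).card : ℝ) := by exact_mod_cast Finset.card_biUnion_le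
      _ ≤ pairs.card • ((m : ℝ) ^ (m * d) * (1 / 8) ^ m) := Finset.sum_le_card_nsmul _ _ _ hbad
      _ ≤ 4 ^ m * ((m : ℝ) ^ (m * d) * (1 / 8) ^ m) := by
          rw [nsmul_eq_mul]; gcongr
  have hhalf : (4 : ℝ) ^ m * (1 / 8) ^ m < 1 := by
    rw [← mul_pow]; exact pow_lt_one₀ (by norm_num) (by norm_num) hm0.ne'
  have hpos : (0 : ℝ) < (m : ℝ) ^ (m * d) := by positivity
  nlinarith

/-- `N` connects any two subsets of `S` that contain at least the fraction `ε` of `S`. -/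
def IsExpander {V : Type} (ε : ℝ) (S : Finset V) (N : V → Finset V) : Prop :=
  ∀ X ⊆ S, ∀ Y ⊆ S, ε * S.card ≤ X.card → ε * S.card ≤ Y.card → ∃ a ∈ X, ∃ b ∈ Y, b ∈ N a

/-- The previous theorem is applied to `S` as a type, and vertices outside `S` get no neighbours.
The degree is fixed before `V` and `S`, so one constant serves all blocks. -/
theorem exists_isExpander {ε : ℝ} (hε : 0 < ε) (hε1 : ε < 1) :
    ∃ d : ℕ, ∀ (V : Type) [DecidableEq V] (S : Finset V), ∃ N : V → Finset V,
      (∀ p, (N p).card ≤ d) ∧ (S.Nonempty → IsExpander ε S N) := by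
  obtain ⟨d, hd⟩ := exists_expander_type hε hε1
  refine ⟨d, fun V _ S => ?_⟩
  rcases S.eq_empty_or_nonempty with rfl | hS
  · exact ⟨fun _ => ∅, by simp, fun h => absurd h (by simp)⟩
  · have : Nonempty S := hS.to_subtype
    obtain ⟨g, hg⟩ := hd S
    refine ⟨fun p => if hp : p ∈ S then Finset.univ.image fun i => (g (⟨p, hp⟩, i) : V) else ∅,
      fun p => ?_, fun _ X hX Y hY hXc hYc => ?_⟩
    · dsimp only
      split_ifs
      · exact Finset.card_image_le.trans (by simp)
      · simp
    · obtain ⟨a, ha, i, hi⟩ := hg (X.subtype (· ∈ S)) (Y.subtype (· ∈ S))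
        (by rw [Finset.card_subtype, Finset.filter_true_of_mem hX]; simpa using hXc)
        (by rw [Finset.card_subtype, Finset.filter_true_of_mem hY]; simpa using hYc)
      exact ⟨a, by simpa using ha, _, Finset.mem_subtype.1 hi, by simp⟩

end Expanders

/-! ### Voting, and forwarding certificates along an expander. -/

section Certificates

open Classical

variable {n ℓ : ℕ}

/-- The message `m` contains the value `w` and `r`'s signature on it with stamp `t`. -/
def View.Supports (m : View n) (t : ℕ) (w : Value ℓ) (r : Fin n) : Prop :=
  m.payload = w.1 ∧ some ⟨r, stamp t w.1⟩ ∈ m.checked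

namespace Program

/-- The members of `S` that are seen to vote for `w`, when the votes come in `i`. -/
noncomputable def voters (S : Finset (Fin n)) (t : ℕ) (i : Inbox n) (w : Value ℓ) :
    Finset (Fin n) :=
  S.filter fun q => (i q).Supports t w q

/-- The value with at least `θ` votes. -/
noncomputable def elected (S : Finset (Fin n)) (θ : ℝ) (t : ℕ) (i : Inbox n) : Option (Value ℓ) :=
  if h : ∃ w : Value ℓ, θ ≤ (voters S t i w).card then some h.choose else none

/-- A signed vote for `u`. -/
def voteMessage (S : Finset (Fin n)) (p : Fin n) (t : ℕ) (u : Option (Value ℓ)) (q : Fin n) :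
    Message n :=
  if q ∈ S then u.elim Message.silent fun v => ⟨v.1, [⟨p, stamp t v.1⟩]⟩ else Message.silent

/-- The certificate for the elected value. Missing signatures are replaced with dummies. -/
noncomputable def certificate (S M : Finset (Fin n)) (θ : ℝ) (p : Fin n) (t : ℕ) (i : Inbox n)
    (q : Fin n) : Message n :=
  if q ∈ M then (elected (ℓ := ℓ) S θ t i).elim Message.silent fun w =>
    ⟨w.1, S.toList.map fun r => if r ∈ voters S t i w then ⟨r, stamp t w.1⟩ else ⟨p, []⟩⟩
  else Message.silent

/-- The values for which a certificate arrives in `j`. -/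
def certified (S : Finset (Fin n)) (θ : ℝ) (t : ℕ) (j : Inbox n) : Set (Value ℓ) :=
  {w | ∃ q, θ ≤ (S.filter fun r => (j q).Supports t w r).card}

/-- The values with a certificate that is known from the votes `i` or from what arrives in `j`. -/
def known (S : Finset (Fin n)) (θ : ℝ) (t : ℕ) (i j : Inbox n) : Set (Value ℓ) :=
  {w | elected S θ t i = some w ∨ w ∈ certified S θ t j}

/-- The parties of `S` vote, and forward a certificate of at least `θ` votes to the neighbours `M`.
The result is the value elected by the votes and the set of all values with a known certificate. -/
noncomputable def certify (S M : Finset (Fin n)) (θ : ℝ) (p : Fin n) (t : ℕ)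
    (u : Option (Value ℓ)) : Program n (Option (Value ℓ) × Set (Value ℓ)) :=
  round (voteMessage S p t u) (fun q b => [⟨q, stamp t b⟩]) fun i =>
    round (certificate (ℓ := ℓ) S M θ p t i) (fun _ b => S.toList.map fun r => ⟨r, stamp t b⟩)
      fun j => pure (elected S θ t i, known S θ t i j)

theorem hasLength_certify (S M : Finset (Fin n)) (θ : ℝ) (p : Fin n) (t : ℕ)
    (u : Option (Value ℓ)) : (certify S M θ p t u).HasLength 2 :=
  .round fun _ => .round fun _ => .pure _

theorem sum_bits_le {κ b : ℕ} (S : Finset (Fin n)) (m : Fin n → Message n)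
    (hb : ∀ q, (m q).bits κ ≤ if q ∈ S then b else 0) : ∑ q, (m q).bits κ ≤ S.card * b := by
  refine (Finset.sum_le_sum fun q _ => hb q).trans ?_
  rw [Finset.sum_ite]
  simp

/-- Only the neighbours in `M` receive the `S.card` signatures of a certificate. For `M` of bounded
size the cost is linear in `S.card`. -/
theorem costLE_certify {κ : ℕ} (S M : Finset (Fin n)) (θ : ℝ) (p : Fin n) (t : ℕ)
    (u : Option (Value ℓ)) :
    (certify S M θ p t u).CostLE κ (S.card * (ℓ + κ) + M.card * (ℓ + κ * S.card)) := by
  refine ⟨M.card * (ℓ + κ * S.card), Nat.add_le_add_right ?_ _, fun i => ⟨0, ?_, fun j => trivial⟩⟩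
  · refine sum_bits_le _ _ fun q => ?_
    unfold voteMessage
    split_ifs
    · cases u with
      | none => simp [Message.bits, Message.silent]
      | some v => simpa [Message.bits] using v.2
    · simp [Message.bits, Message.silent]
  · refine sum_bits_le _ _ fun q => ?_
    unfold certificate
    split_ifs
    · cases elected (ℓ := ℓ) S θ t i with
      | none => simp [Message.bits, Message.silent]
      | some v => simpa [Message.bits] using v.2
    · simp [Message.bits, Message.silent]

end Program

/-- Signatures are checked by position. Sender and recipient both list `S` in the order of
`S.toList`, so the slot of `r` is checked against the signature of `r`; this is why gaps are filled
with dummies. -/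
theorem view_map_checked {S : Finset (Fin n)} {b : List Bool} {g k : Fin n → Sig n} {s : Sig n}
    (r : Fin n) (hr : r ∈ S) (hg : g r = s) (hk : k r = s) :
    some s ∈ ((⟨b, S.toList.map g⟩ : Message n).view (S.toList.map k)).checked := by
  have : r ∈ S.toList := Finset.mem_toList.2 hr
  simp only [Message.view]
  generalize S.toList = l at this
  induction l with
  | nil => simp at this
  | cons a l ih =>
    rcases List.mem_cons.1 this with rfl | h
    · simp [hg, hk]
    · simpa using Or.inr (by simpa using ih h)

namespace Execution

open Program

variable {A : Fin n → Value ℓ → Program n (Value ℓ)} (e : Execution (Program.toProtocol A))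

/-- The honest members of `S`. -/
noncomputable def honestIn (S : Finset (Fin n)) : Finset (Fin n) := S.filter e.Honest

/-- At least the fraction `1 / 2 + ε` of `S` is honest. -/
def Good (ε : ℝ) (S : Finset (Fin n)) : Prop := (1 / 2 + ε) * S.card ≤ (e.honestIn S).card

variable {e}

theorem mem_honestIn {S : Finset (Fin n)} {p : Fin n} :
    p ∈ e.honestIn S ↔ p ∈ S ∧ e.Honest p := Finset.mem_filter

/-- Inclusion–exclusion: two subsets with the fraction `1 / 2 + ε` each overlap in the fraction `2 *
ε`. -/
theorem Good.le_card_inter {ε : ℝ} {S : Finset (Fin n)} (h : e.Good ε S) {Q : Finset (Fin n)}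
    (hQ : Q ⊆ S) (hQc : (1 / 2 + ε) * S.card ≤ Q.card) :
    2 * ε * S.card ≤ (Q ∩ e.honestIn S).card := by
  have h1 := Finset.card_union_add_card_inter Q (e.honestIn S)
  have h2 : (Q ∪ e.honestIn S).card ≤ S.card :=
    Finset.card_le_card (Finset.union_subset hQ (Finset.filter_subset _ _))
  have h3 : Q.card + (e.honestIn S).card ≤ S.card + (Q ∩ e.honestIn S).card := by omega
  have h4 : (Q.card + (e.honestIn S).card : ℝ) ≤ S.card + (Q ∩ e.honestIn S).card := by
    exact_mod_cast h3
  unfold Good at h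
  linarith

/-- The guarantees of `Program.certify` for the votes `u` and the results `out`. -/
structure CertifySpec (e : Execution (Program.toProtocol A)) (ε : ℝ) (S : Finset (Fin n))
    (u : Fin n → Option (Value ℓ)) (out : Fin n → Option (Value ℓ) × Set (Value ℓ)) : Prop where
  mem_of_elected : ∀ p w, (out p).1 = some w → w ∈ (out p).2
  honest_votes : ∀ p ∈ e.honestIn S, ∀ w ∈ (out p).2,
    2 * ε * S.card ≤ ((e.honestIn S).filter fun q => u q = some w).card
  spread : ∀ w, ε * S.card ≤ ((e.honestIn S).filter fun q => (out q).1 = some w).card →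
    ((e.honestIn S).filter fun q => w ∉ (out q).2).card < ε * S.card
  unanimous : ∀ v, (∀ p ∈ e.honestIn S, u p = some v) → ∀ p ∈ e.honestIn S, (out p).1 = some v

/-- A quorum of `θ` signatures contains many honest ones, which by unforgeability are real votes.
The expander spreads certificates, and `θ` is low enough for the honest members alone to form a
quorum. -/
theorem certify_spec {ε : ℝ} (hε : 0 < ε) {S : Finset (Fin n)} (hS : S.Nonempty)
    (hgood : e.Good ε S) {N : Fin n → Finset (Fin n)} (hN : IsExpander ε S N) {t : ℕ}
    {u : Fin n → Option (Value ℓ)}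
    {k : Fin n → Option (Value ℓ) × Set (Value ℓ) → Program n (Value ℓ)}
    (hres : ∀ p ∈ e.honestIn S, e.residual p t =
      (certify S (N p) ((1 / 2 + ε) * S.card) p t (u p)).bind (k p)) :
    ∃ out, (∀ p ∈ e.honestIn S, e.residual p (t + 2) = k p (out p)) ∧ e.CertifySpec ε S u out := by
  set θ : ℝ := (1 / 2 + ε) * S.card with hθ
  have hSpos : (0 : ℝ) < S.card := by exact_mod_cast hS.card_pos
  have hres1 : ∀ p ∈ e.honestIn S, e.residual p (t + 1) =
      round (certificate (ℓ := ℓ) S (N p) θ p t (e.inbox p t))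
        (fun _ b => S.toList.map fun r => ⟨r, stamp t b⟩) fun j =>
          k p (elected S θ t (e.inbox p t),
            known S θ t (e.inbox p t) j) := fun p hp => by
    rw [residual_succ, hres p hp]; rfl
  have hvote : ∀ p ∈ e.honestIn S, ∀ q, e.sent t p q = voteMessage S p t (u p) q := by
    intro p hp q
    have hout : (e.residual p t).outgoing q = voteMessage S p t (u p) q := by
      rw [hres p hp]; rfl
    rw [← hout]
    refine e.sent_eq_of_mayAttach (mem_honestIn.1 hp).2 q fun s hs => Or.inl ?_
    rw [hout] at hs
    rw [e.length_hist]
    unfold voteMessage at hs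
    split_ifs at hs
    · cases hu : u p with
      | none => simp [hu, Message.silent] at hs
      | some v =>
        simp only [hu, Option.elim, List.mem_singleton] at hs
        subst hs
        exact ⟨rfl, Or.inr ⟨_, rfl⟩⟩
    · simp [Message.silent] at hs
  have hcert : ∀ p ∈ e.honestIn S, ∀ q,
      e.sent (t + 1) p q = certificate (ℓ := ℓ) S (N p) θ p t (e.inbox p t) q := by
    intro p hp q
    have hout : (e.residual p (t + 1)).outgoing q =
        certificate (ℓ := ℓ) S (N p) θ p t (e.inbox p t) q := by
      rw [hres1 p hp]; rfl
    rw [← hout]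
    refine e.sent_eq_of_mayAttach (mem_honestIn.1 hp).2 q fun s hs => ?_
    rw [hout] at hs
    unfold certificate at hs
    split_ifs at hs
    · cases hu : elected (ℓ := ℓ) S θ t (e.inbox p t) with
      | none => simp [hu, Message.silent] at hs
      | some v =>
        simp only [hu, Option.elim, List.mem_map] at hs
        obtain ⟨r, -, rfl⟩ := hs
        split_ifs with hr
        · exact Or.inr ⟨_, e.mem_hist.2 ⟨t, by omega, rfl⟩, r, (Finset.mem_filter.1 hr).2.2⟩
        · exact Or.inl ⟨rfl, Or.inl rfl⟩
    · simp [Message.silent] at hs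
  -- The stamp traces the signature back to round `t`, in which the honest `q` signs nothing but its
  -- vote.
  have hsigner : ∀ q ∈ e.honestIn S, ∀ (w : Value ℓ) t' p r,
      (⟨q, stamp t w.1⟩ : Sig n) ∈ (e.sent t' p r).sigs → u q = some w := by
    intro q hq w t' p r h
    obtain ⟨r', hr'⟩ := e.signer_sent (mem_honestIn.1 hq).2 h
    rw [hvote q hq] at hr'
    unfold voteMessage at hr'
    split_ifs at hr'
    · cases hu : u q with
      | none => simp [hu, Message.silent] at hr'
      | some v =>
        simp only [hu, Option.elim, List.mem_singleton, Sig.mk.injEq, true_and] at hr'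
        rw [Subtype.ext (stamp_inj hr').2]
    · simp [Message.silent] at hr'
  have hquorum : ∀ (w : Value ℓ) (Q : Finset (Fin n)), Q ⊆ S → θ ≤ Q.card →
      (∀ q ∈ Q, ∃ t' p r, (⟨q, stamp t w.1⟩ : Sig n) ∈ (e.sent t' p r).sigs) →
      2 * ε * S.card ≤ ((e.honestIn S).filter fun q => u q = some w).card := by
    intro w Q hQ hQc h
    refine (hgood.le_card_inter hQ hQc).trans ?_
    refine Nat.cast_le.2 (Finset.card_le_card fun q hq => ?_)
    obtain ⟨hqQ, hqH⟩ := Finset.mem_inter.1 hq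
    obtain ⟨t', p, r, h'⟩ := h q hqQ
    exact Finset.mem_filter.2 ⟨hqH, hsigner q hqH w t' p r h'⟩
  have helected : ∀ p (w : Value ℓ), elected S θ t (e.inbox p t) = some w →
      θ ≤ (voters S t (e.inbox p t) w).card := by
    intro p w h
    unfold elected at h
    split_ifs at h with hex
    cases h
    exact hex.choose_spec
  refine ⟨fun p => (elected S θ t (e.inbox p t),
    known S θ t (e.inbox p t) (e.inbox p (t + 1))),
    fun p hp => ?_, fun p w h => Or.inl h, fun p hp w hw => ?_, fun w hw => ?_, fun v hv p hp => ?_⟩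
  · rw [show t + 2 = (t + 1) + 1 from rfl, residual_succ, hres1 p hp]; rfl
  · rcases hw with hw | ⟨q, hq⟩
    · refine hquorum w _ (Finset.filter_subset _ _) (helected p w hw) fun q hq => ?_
      exact ⟨t, q, p, Message.mem_sigs_of_mem_view (Finset.mem_filter.1 hq).2.2⟩
    · refine hquorum w _ (Finset.filter_subset _ _) hq fun r hr => ?_
      exact ⟨t + 1, q, p, Message.mem_sigs_of_mem_view (Finset.mem_filter.1 hr).2.2⟩
  · by_contra! hcon
    -- The expander yields an edge from some `a` that elected `w` to some `b` ignorant of `w`, but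
    -- the certificate of `a` reaches `b`.
    obtain ⟨a, ha, b, hb, hab⟩ := hN _
      ((Finset.filter_subset _ _).trans (Finset.filter_subset _ _)) _
      ((Finset.filter_subset _ _).trans (Finset.filter_subset _ _)) hw hcon
    obtain ⟨haH, haw⟩ := Finset.mem_filter.1 ha
    obtain ⟨hbH, hbw⟩ := Finset.mem_filter.1 hb
    refine hbw (Or.inr ⟨a, (helected a w haw).trans ?_⟩)
    refine Nat.cast_le.2 (Finset.card_le_card fun r hr => Finset.mem_filter.2
      ⟨(Finset.mem_filter.1 hr).1, ?_⟩)
    have hin : e.inbox b (t + 1) a =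
        (⟨w.1, S.toList.map fun r => if r ∈ voters S t (e.inbox a t) w then ⟨r, stamp t w.1⟩
          else ⟨a, []⟩⟩ : Message n).view (S.toList.map fun r => ⟨r, stamp t w.1⟩) := by
      simp only [inbox, hres1 b hbH, hcert a haH, certificate, hab, if_true]
      simp only at haw
      rw [haw]
      rfl
    rw [hin]
    exact ⟨rfl, view_map_checked r (Finset.mem_filter.1 hr).1 (by simp [hr]) rfl⟩
  · have hvoters : e.honestIn S ⊆ voters S t (e.inbox p t) v := fun q hq => by
      refine Finset.mem_filter.2 ⟨(mem_honestIn.1 hq).1, ?_⟩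
      simp only [inbox, hres p hp, hvote q hq, hv q hq, voteMessage, (mem_honestIn.1 hp).1, if_true]
      exact ⟨rfl, by simp [Message.view, certify, Program.bind, expected]⟩
    have hex : ∃ w : Value ℓ, θ ≤ (voters S t (e.inbox p t) w).card :=
      ⟨v, hgood.trans (Nat.cast_le.2 (Finset.card_le_card hvoters))⟩
    have hsome : elected S θ t (e.inbox p t) = some hex.choose := dif_pos hex
    -- The chosen value is not known to be `v` yet, but it has an honest voter, and these all vote
    -- for `v`.
    have hpos := hquorum _ _ (Finset.filter_subset _ _) hex.choose_spec fun q hq =>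
      ⟨t, q, p, Message.mem_sigs_of_mem_view (Finset.mem_filter.1 hq).2.2⟩
    have : (0 : ℝ) < ((e.honestIn S).filter fun q => u q = some hex.choose).card :=
      lt_of_lt_of_le (by positivity) hpos
    obtain ⟨q, hq⟩ := Finset.card_pos.1 (Nat.cast_pos.1 this)
    obtain ⟨hqH, hqu⟩ := Finset.mem_filter.1 hq
    rw [hv q hqH] at hqu
    simp only
    rw [hsome, ← hqu]

end Execution

end Certificates

/-! ### Graded consensus, and one phase of the recursion. -/

section Phases

open Classical

variable {n ℓ : ℕ}

/-- Reading an announcement. -/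
def parse : List Bool → Option (Bool × Value ℓ)
  | [] => none
  | b :: l => if h : l.length ≤ ℓ then some (b, ⟨l, h⟩) else none

namespace Program

/-- The message by which a marked value is announced to `S`. -/
def announcement (S : Finset (Fin n)) (m : Option (Bool × Value ℓ)) (q : Fin n) : Message n :=
  if q ∈ S then m.elim Message.silent fun x => ⟨x.1 :: x.2.1, []⟩ else Message.silent

/-- Announce a marked value to `S` without signing it. The result is what everybody announces. -/
def announce (S : Finset (Fin n)) (m : Option (Bool × Value ℓ)) :
    Program n (Fin n → Option (Bool × Value ℓ)) :=
  round (announcement S m) (fun _ _ => []) fun i => pure fun q => parse (i q).payload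

theorem hasLength_announce (S : Finset (Fin n)) (m : Option (Bool × Value ℓ)) :
    (announce S m).HasLength 1 := .round fun _ => .pure _

theorem costLE_announce {κ : ℕ} (S : Finset (Fin n)) (m : Option (Bool × Value ℓ)) :
    (announce S m).CostLE κ (S.card * (ℓ + 1)) := by
  refine ⟨0, sum_bits_le _ _ fun q => ?_, fun i => trivial⟩
  unfold announcement
  split_ifs
  · cases m with
    | none => simp [Message.bits, Message.silent]
    | some x => simpa [Message.bits] using x.2.2
  · simp [Message.bits, Message.silent]

/-- The members of `F` that announce `w`. -/
noncomputable def announcers (F : Finset (Fin n)) (c : Fin n → Option (Bool × Value ℓ))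
    (w : Value ℓ) : Finset (Fin n) :=
  F.filter fun q => ∃ b, c q = some (b, w)

/-- The value that is announced by more than half of `F`, by default `v`. -/
noncomputable def majority (F : Finset (Fin n)) (c : Fin n → Option (Bool × Value ℓ))
    (v : Value ℓ) : Value ℓ :=
  if h : ∃ w, F.card < 2 * (announcers F c w).card then h.choose else v

/-- Two majorities of `F` would share a member, and each member announces a single value. -/
theorem majority_eq {F : Finset (Fin n)} {c : Fin n → Option (Bool × Value ℓ)} {w : Value ℓ}
    (h : F.card < 2 * (announcers F c w).card) (v : Value ℓ) : majority F c v = w := by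
  have hex : ∃ w, F.card < 2 * (announcers F c w).card := ⟨w, h⟩
  rw [majority, dif_pos hex]
  by_contra hne
  have hdisj : Disjoint (announcers F c hex.choose) (announcers F c w) := by
    refine Finset.disjoint_left.2 fun q h1 h2 => hne ?_
    obtain ⟨b, hb⟩ := (Finset.mem_filter.1 h1).2
    obtain ⟨b', hb'⟩ := (Finset.mem_filter.1 h2).2
    rw [hb] at hb'
    simpa using congrArg (Option.map Prod.snd) hb'
  have h1 : (announcers F c hex.choose ∪ announcers F c w).card ≤ F.card :=
    Finset.card_le_card (Finset.union_subset (Finset.filter_subset _ _) (Finset.filter_subset _ _))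
  rw [Finset.card_union_of_disjoint hdisj] at h1
  have h2 := hex.choose_spec
  omega

/-- The elected value with mark `true`, or else any certified value with mark `false`. -/
noncomputable def report (o : Option (Value ℓ) × Set (Value ℓ)) : Option (Bool × Value ℓ) :=
  if h : ∃ w, o.1 = some w then some (true, h.choose)
  else if h : ∃ w, w ∈ o.2 then some (false, h.choose) else none

theorem report_of_elected {o : Option (Value ℓ) × Set (Value ℓ)} {w : Value ℓ}
    (h : o.1 = some w) : report o = some (true, w) := by
  have hex : ∃ w, o.1 = some w := ⟨w, h⟩
  rw [report, dif_pos hex, Option.some_injective _ (hex.choose_spec.symm.trans h)]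

theorem elected_of_report {o : Option (Value ℓ) × Set (Value ℓ)} {w : Value ℓ}
    (h : report o = some (true, w)) : o.1 = some w := by
  unfold report at h
  split_ifs at h with h1 h2
  · simp only [Option.some.injEq, Prod.mk.injEq, true_and] at h
    rw [← h]; exact h1.choose_spec
  · simp at h

/-- When only one value is certified, the arbitrary choice in `report` is forced. -/
theorem exists_report {o : Option (Value ℓ) × Set (Value ℓ)} (ho : ∀ w, o.1 = some w → w ∈ o.2)
    {w : Value ℓ} (hw : w ∈ o.2) (huniq : ∀ x ∈ o.2, x = w) : ∃ b, report o = some (b, w) := by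
  unfold report
  split_ifs with h1 h2
  · exact ⟨true, by rw [huniq _ (ho _ h1.choose_spec)]⟩
  · exact ⟨false, by rw [huniq _ h2.choose_spec]⟩
  · exact absurd ⟨w, hw⟩ h2

/-- The second vote: the elected value, provided that no other value is known to have a
certificate. -/
noncomputable def confirm (o : Option (Value ℓ) × Set (Value ℓ)) : Option (Value ℓ) :=
  o.1.filter fun w => ∀ x ∈ o.2, x = w

theorem confirm_eq_some {o : Option (Value ℓ) × Set (Value ℓ)} {w : Value ℓ} :
    confirm o = some w ↔ o.1 = some w ∧ ∀ x ∈ o.2, x = w := by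
  simp [confirm, Option.filter_eq_some_iff]

/-- Graded consensus among `S`: two certified votes and an announcement. -/
noncomputable def graded (S M : Finset (Fin n)) (θ : ℝ) (p : Fin n) (t : ℕ) (v : Value ℓ) :
    Program n (Value ℓ × Prop) :=
  (certify S M θ p t (some v)).bind fun o =>
    (certify S M θ p (t + 2) (confirm o)).bind fun o' =>
      (announce S (report o')).bind fun c =>
        pure (majority S c v, θ ≤ (S.filter fun q => c q = some (true, majority S c v)).card)

theorem hasLength_graded (S M : Finset (Fin n)) (θ : ℝ) (p : Fin n) (t : ℕ) (v : Value ℓ) :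
    (graded S M θ p t v).HasLength 5 :=
  (hasLength_certify S M θ p t _).bind fun _ => (hasLength_certify S M θ p _ _).bind fun _ =>
    (hasLength_announce S _).bind fun _ => .pure _

/-- Graded consensus among `S`, agreement among the part `S'` of `S` by the program `inner`, which
takes `r` rounds, and adoption of its result by the parties of `S` without grade. -/
noncomputable def phase (S S' M : Finset (Fin n)) (θ : ℝ) (r : ℕ) (p : Fin n)
    (inner : ℕ → Value ℓ → Program n (Value ℓ)) (t : ℕ) (v : Value ℓ) : Program n (Value ℓ) :=
  (graded S M θ p t v).bind fun o =>
    (if p ∈ S' then inner (t + 5) o.1 else idle o.1 r).bind fun x =>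
      (announce S (if p ∈ S' then some (true, x) else none)).bind fun c =>
        pure (if o.2 then o.1 else majority S' c o.1)

theorem hasLength_inner {S' : Finset (Fin n)} {r : ℕ} {p : Fin n}
    {inner : ℕ → Value ℓ → Program n (Value ℓ)} (h : ∀ t v, (inner t v).HasLength r)
    (t : ℕ) (v : Value ℓ) : (if p ∈ S' then inner t v else idle v r).HasLength r := by
  split_ifs
  · exact h _ _
  · exact hasLength_idle _ _

theorem hasLength_phase {S S' M : Finset (Fin n)} {θ : ℝ} {r : ℕ} {p : Fin n}
    {inner : ℕ → Value ℓ → Program n (Value ℓ)} (h : ∀ t v, (inner t v).HasLength r)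
    (t : ℕ) (v : Value ℓ) : (phase S S' M θ r p inner t v).HasLength (r + 6) := by
  have := (hasLength_graded S M θ p t v).bind fun o => (hasLength_inner (S' := S') (p := p) h
    (t + 5) o.1).bind fun x => (hasLength_announce S (if p ∈ S' then some (true, x) else none)).bind
      fun c => HasLength.pure (n := n) (if o.2 then o.1 else majority S' c o.1)
  rwa [show r + 6 = 5 + (r + (1 + 0)) by omega]

/-- Each of the two certified votes costs `d + 1` units and each of the two announcements one unit.
The recursion is charged only to members of `S'`. -/
theorem costLE_phase {κ c d k b : ℕ} (hκ : 0 < κ) {S S' M : Finset (Fin n)} (hS : S.card ≤ 2 ^ k)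
    (hM : M.card ≤ d) {θ : ℝ} {r : ℕ} {p : Fin n}
    {inner : ℕ → Value (c * κ) → Program n (Value (c * κ))} (h : ∀ t v, (inner t v).CostLE κ b)
    (t : ℕ) (v : Value (c * κ)) : (phase S S' M θ r p inner t v).CostLE κ
      ((2 * d + 4) * ((c + 1) * κ * 2 ^ k) + if p ∈ S' then b else 0) := by
  have hinner : ∀ t v, (if p ∈ S' then inner t v else idle v r).CostLE κ
      (if p ∈ S' then b else 0) := fun t v => by
    split_ifs
    · exact h _ _
    · exact costLE_idle _ _ _
  have hpow : 1 ≤ 2 ^ k := Nat.one_le_two_pow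
  have hcert : S.card * (c * κ + κ) + M.card * (c * κ + κ * S.card) ≤
      (d + 1) * ((c + 1) * κ * 2 ^ k) := by
    have h1 : S.card * (c * κ + κ) ≤ 2 ^ k * (c * κ + κ) := Nat.mul_le_mul_right _ hS
    have h2 : c * κ + κ * S.card ≤ c * κ * 2 ^ k + κ * 2 ^ k :=
      Nat.add_le_add (Nat.le_mul_of_pos_right _ (by omega)) (Nat.mul_le_mul_left _ hS)
    have h3 := Nat.mul_le_mul hM h2
    nlinarith
  -- The mark costs one bit, which is at most `κ` by `hκ`.
  have hann : S.card * (c * κ + 1) ≤ (c + 1) * κ * 2 ^ k := by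
    have := Nat.mul_le_mul hS (Nat.add_le_add_left (Nat.succ_le_of_lt hκ) (c * κ))
    nlinarith
  refine CostLE.mono ((((costLE_certify S M θ p t _).bind fun o =>
    (costLE_certify S M θ p (t + 2) _).bind fun o' => (costLE_announce S _).bind fun c =>
      costLE_pure κ _).bind fun o => (hinner _ _).bind fun x =>
        (costLE_announce S _).bind fun c => costLE_pure κ _)) ?_
  have : (2 * d + 4) * ((c + 1) * κ * 2 ^ k) = (d + 1) * ((c + 1) * κ * 2 ^ k) +
    (d + 1) * ((c + 1) * κ * 2 ^ k) + (c + 1) * κ * 2 ^ k + (c + 1) * κ * 2 ^ k := by ring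
  omega

end Program

namespace Execution

open Program

variable {A : Fin n → Value ℓ → Program n (Value ℓ)} {e : Execution (Program.toProtocol A)}

theorem announce_spec {S : Finset (Fin n)} {t : ℕ} {m : Fin n → Option (Bool × Value ℓ)}
    {k : Fin n → (Fin n → Option (Bool × Value ℓ)) → Program n (Value ℓ)}
    (hres : ∀ p ∈ e.honestIn S, e.residual p t = (announce S (m p)).bind (k p)) :
    ∃ c : Fin n → Fin n → Option (Bool × Value ℓ),
      (∀ p ∈ e.honestIn S, e.residual p (t + 1) = k p (c p)) ∧
        ∀ p ∈ e.honestIn S, ∀ q ∈ e.honestIn S, c p q = m q := by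
  refine ⟨fun p q => parse (e.inbox p t q).payload,
    fun p hp => by rw [residual_succ, hres p hp]; rfl, fun p hp q hq => ?_⟩
  have hout : (e.residual q t).outgoing p = announcement S (m q) p := by
    rw [hres q hq]; rfl
  have hsent : e.sent t q p = announcement S (m q) p := by
    rw [← hout]
    refine e.sent_eq_of_mayAttach (mem_honestIn.1 hq).2 p fun s hs => ?_
    rw [hout, announcement, if_pos (mem_honestIn.1 hp).1] at hs
    cases hm : m q <;> simp [hm, Message.silent] at hs
  simp only [inbox, hsent, announcement, (mem_honestIn.1 hp).1, if_true, Message.view]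
  cases hm : m q with
  | none => simp [Message.silent, parse]
  | some x => simp [parse, x.2.2]

/-- The guarantees of graded consensus with inputs `v` and results `out`. -/
structure GradedSpec (e : Execution (Program.toProtocol A)) (S : Finset (Fin n))
    (v : Fin n → Value ℓ) (out : Fin n → Value ℓ × Prop) : Prop where
  unanimous : ∀ w, (∀ p ∈ e.honestIn S, v p = w) → ∀ p ∈ e.honestIn S, (out p).1 = w ∧ (out p).2
  consistent : ∀ p ∈ e.honestIn S, (out p).2 → ∀ q ∈ e.honestIn S, (out q).1 = (out p).1

/-- A second certificate for `w` means that many honest parties elected `w` at first, so fewer than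
`ε * S.card` honest parties miss its first certificate. Confirming another value `x` requires
missing it, yet `x` needs `2 * ε * S.card` honest confirmations. -/
theorem CertifySpec.eq_of_known {ε : ℝ} (hε : 0 < ε) {S : Finset (Fin n)} (hS : S.Nonempty)
    {u : Fin n → Option (Value ℓ)} {o o' : Fin n → Option (Value ℓ) × Set (Value ℓ)}
    (h : e.CertifySpec ε S u o) (h' : e.CertifySpec ε S (fun p => confirm (o p)) o')
    {p q : Fin n} (hp : p ∈ e.honestIn S) (hq : q ∈ e.honestIn S) {w x : Value ℓ}
    (hw : w ∈ (o' p).2) (hx : x ∈ (o' q).2) : x = w := by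
  have hSpos : (0 : ℝ) < ε * S.card := mul_pos hε (by exact_mod_cast hS.card_pos)
  by_contra hne
  have hw1 := h'.honest_votes p hp w hw
  have hx1 := h'.honest_votes q hq x hx
  have hw2 := h.spread w (le_trans (by linarith) (hw1.trans (Nat.cast_le.2
    (Finset.card_le_card (Finset.monotone_filter_right _ fun r _ hr =>
      (confirm_eq_some.1 hr).1)))))
  have hx2 := hx1.trans (Nat.cast_le.2 (Finset.card_le_card
    (Finset.monotone_filter_right (e.honestIn S) (q := fun r => w ∉ (o r).2) fun r _ hr hwr =>
      hne ((confirm_eq_some.1 hr).2 w hwr).symm)))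
  linarith

/-- A grade for `w` shows that the fraction `2 * ε` of `S` is honest and elected `w` in the second
vote. Hence all but fewer than `ε * S.card` honest parties know a second certificate, which can only
be for `w`, and more than half of `S` announces `w` to everybody. -/
theorem graded_spec {ε : ℝ} (hε : 0 < ε) {S : Finset (Fin n)} (hS : S.Nonempty)
    (hgood : e.Good ε S) {N : Fin n → Finset (Fin n)} (hN : IsExpander ε S N) {t : ℕ}
    {v : Fin n → Value ℓ} {k : Fin n → Value ℓ × Prop → Program n (Value ℓ)}
    (hres : ∀ p ∈ e.honestIn S, e.residual p t =
      (graded S (N p) ((1 / 2 + ε) * S.card) p t (v p)).bind (k p)) :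
    ∃ out, (∀ p ∈ e.honestIn S, e.residual p (t + 5) = k p (out p)) ∧ e.GradedSpec S v out := by
  simp only [graded, Program.bind_assoc] at hres
  obtain ⟨o, hres, ho⟩ := certify_spec (u := fun p => some (v p)) hε hS hgood hN hres
  obtain ⟨o', hres, ho'⟩ := certify_spec (u := fun p => confirm (o p)) hε hS hgood hN hres
  obtain ⟨c, hres, hc⟩ := announce_spec (m := fun p => report (o' p)) hres
  have hSpos : (0 : ℝ) < ε * S.card := mul_pos hε (by exact_mod_cast hS.card_pos)
  have hmaj : ∀ (p : Fin n) (w x : Value ℓ) (Q : Finset (Fin n)), (S.card : ℝ) / 2 < Q.card →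
      Q ⊆ announcers S (c p) w → majority S (c p) x = w := by
    intro p w x Q hQ hsub
    refine majority_eq ?_ x
    have : (S.card : ℝ) < 2 * (announcers S (c p) w).card := by
      have : (Q.card : ℝ) ≤ (announcers S (c p) w).card := Nat.cast_le.2 (Finset.card_le_card hsub)
      linarith
    exact_mod_cast this
  refine ⟨_, hres, fun w hw p hp => ?_, fun p hp hgrade q hq => ?_⟩
  · have h1 := ho.unanimous w fun p hp => by rw [hw p hp]
    have h2 := ho'.unanimous w fun p hp => confirm_eq_some.2 ⟨h1 p hp, fun x hx => by
      have : (0 : ℝ) < _ := lt_of_lt_of_le (by linarith) (ho.honest_votes p hp x hx)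
      obtain ⟨q, hq⟩ := Finset.card_pos.1 (Nat.cast_pos.1 this)
      obtain ⟨hqH, hqx⟩ := Finset.mem_filter.1 hq
      rw [hw q hqH] at hqx
      exact (Option.some_injective _ hqx).symm⟩
    have h3 : ∀ q ∈ e.honestIn S, c p q = some (true, w) := fun q hq => by
      rw [hc p hp q hq]; exact report_of_elected (h2 q hq)
    have h4 : majority S (c p) (v p) = w := by
      refine hmaj p w _ (e.honestIn S) ?_ fun q hq =>
        Finset.mem_filter.2 ⟨(mem_honestIn.1 hq).1, true, h3 q hq⟩
      unfold Good at hgood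
      linarith
    refine ⟨h4, hgood.trans (Nat.cast_le.2 (Finset.card_le_card fun q hq => ?_))⟩
    rw [h4]
    exact Finset.mem_filter.2 ⟨(mem_honestIn.1 hq).1, h3 q hq⟩
  · simp only at hgrade ⊢
    generalize majority S (c p) (v p) = w at hgrade ⊢
    have h1 := (hgood.le_card_inter (Finset.filter_subset _ _) hgrade).trans
      (Nat.cast_le.2 (Finset.card_le_card (t := (e.honestIn S).filter fun r => (o' r).1 = some w)
        fun r hr => by
          obtain ⟨hr, hrH⟩ := Finset.mem_inter.1 hr
          refine Finset.mem_filter.2 ⟨hrH, elected_of_report ?_⟩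
          rw [← (Finset.mem_filter.1 hr).2, hc p hp r hrH]))
    have h2 := ho'.spread w (by linarith)
    obtain ⟨r, hr⟩ := Finset.card_pos.1 (Nat.cast_pos.1 (lt_of_lt_of_le (by linarith) h1))
    obtain ⟨hrH, hr⟩ := Finset.mem_filter.1 hr
    have hwr := ho'.mem_of_elected r w hr
    refine hmaj q w _ ((e.honestIn S).filter fun s => w ∈ (o' s).2) ?_ fun s hs => ?_
    · have h3 := Finset.card_filter_add_card_filter_not (s := e.honestIn S)
        (fun s => w ∈ (o' s).2)
      have h4 : ((((e.honestIn S).filter fun s => w ∈ (o' s).2).card : ℝ) +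
          ((e.honestIn S).filter fun s => w ∉ (o' s).2).card) = (e.honestIn S).card := by
        exact_mod_cast h3
      unfold Good at hgood
      linarith
    · obtain ⟨hsH, hs⟩ := Finset.mem_filter.1 hs
      refine Finset.mem_filter.2 ⟨(mem_honestIn.1 hsH).1, ?_⟩
      rw [hc q hq s hsH]
      exact exists_report (ho'.mem_of_elected s) hs fun x hx =>
        ho.eq_of_known hε hS ho' hrH hsH hwr hx

/-- In the execution `e`, the programs `B` achieve agreement with validity among `S` within `r`
rounds, whenever they are started. -/
def Solves (e : Execution (Program.toProtocol A)) (S : Finset (Fin n)) (r : ℕ)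
    (B : Fin n → ℕ → Value ℓ → Program n (Value ℓ)) : Prop :=
  ∀ (t : ℕ) (v : Fin n → Value ℓ) (k : Fin n → Value ℓ → Program n (Value ℓ)),
    (∀ p ∈ e.honestIn S, e.residual p t = (B p t (v p)).bind (k p)) →
      ∃ out : Fin n → Value ℓ, (∀ p ∈ e.honestIn S, e.residual p (t + r) = k p (out p)) ∧
        (∀ p ∈ e.honestIn S, ∀ q ∈ e.honestIn S, out p = out q) ∧
          ∀ w, (∀ p ∈ e.honestIn S, v p = w) → ∀ p ∈ e.honestIn S, out p = w

/-- Validity does not depend on `S'`, as it comes from the grades alone. For agreement, one grade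
makes the values of all honest parties equal, so validity inside `S'` returns that same value to the
ungraded; without any grade, all adopt the common result of `S'`. -/
theorem phase_spec {ε : ℝ} (hε : 0 < ε) {S S' : Finset (Fin n)} (hS : S.Nonempty)
    (hsub : S' ⊆ S) (hgood : e.Good ε S) {N : Fin n → Finset (Fin n)} (hN : IsExpander ε S N)
    {r : ℕ} {B : Fin n → ℕ → Value ℓ → Program n (Value ℓ)}
    (hlen : ∀ p t v, (B p t v).HasLength r) {t : ℕ}
    {v : Fin n → Value ℓ} {k : Fin n → Value ℓ → Program n (Value ℓ)}
    (hres : ∀ p ∈ e.honestIn S, e.residual p t =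
      (phase S S' (N p) ((1 / 2 + ε) * S.card) r p (B p) t (v p)).bind (k p)) :
    ∃ out : Fin n → Value ℓ,
      (∀ p ∈ e.honestIn S, e.residual p (t + (r + 6)) = k p (out p)) ∧
      (∀ w, (∀ p ∈ e.honestIn S, v p = w) → ∀ p ∈ e.honestIn S, out p = w) ∧
        (S'.Nonempty → e.Good ε S' → e.Solves S' r B →
          ∀ p ∈ e.honestIn S, ∀ q ∈ e.honestIn S, out p = out q) := by
  simp only [phase, Program.bind_assoc] at hres
  obtain ⟨o, hres, ho⟩ := graded_spec hε hS hgood hN hres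
  have hinc : e.honestIn S' ⊆ e.honestIn S := Finset.filter_subset_filter _ hsub
  have hinner : ∃ x : Fin n → Value ℓ, (∀ p ∈ e.honestIn S, e.residual p (t + 5 + r) =
      (announce S (if p ∈ S' then some (true, x p) else none)).bind fun c =>
        (Program.pure (if (o p).2 then (o p).1 else majority S' c (o p).1)).bind (k p)) ∧
      (e.Solves S' r B → (∀ p ∈ e.honestIn S', ∀ q ∈ e.honestIn S', x p = x q) ∧
        ∀ w, (∀ p ∈ e.honestIn S', (o p).1 = w) → ∀ p ∈ e.honestIn S', x p = w) := by
    -- The output must exist before anything is assumed about `S'`, so the fixed length of the inner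
    -- program supplies some result in any case.
    have hany : ∀ p, ∃ x, p ∈ e.honestIn S → e.residual p (t + 5 + r) =
        (announce S (if p ∈ S' then some (true, x) else none)).bind fun c =>
          (Program.pure (if (o p).2 then (o p).1 else majority S' c (o p).1)).bind (k p) := by
      intro p
      by_cases hp : p ∈ e.honestIn S
      · obtain ⟨x, hx⟩ := e.residual_bind_of_hasLength (hasLength_inner (hlen p) _ _) (hres p hp)
        exact ⟨x, fun _ => hx⟩
      · exact ⟨v p, fun h => absurd h hp⟩
    choose y hy using hany
    by_cases hsolves : e.Solves S' r B
    · obtain ⟨z, hz, hz1, hz2⟩ := hsolves (t + 5) (fun p => (o p).1) _ fun p hp => by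
        have := hres p (hinc hp)
        rwa [if_pos (mem_honestIn.1 hp).1] at this
      refine ⟨fun p => if p ∈ S' then z p else y p, fun p hp => ?_, fun _ =>
        ⟨fun p hp q hq => ?_, fun w hw p hp => ?_⟩⟩
      · by_cases hp' : p ∈ S'
        · rw [hz p (mem_honestIn.2 ⟨hp', (mem_honestIn.1 hp).2⟩)]
          simp only [hp', if_true]
        · rw [hy p hp]
          simp only [hp', if_false]
      · simp only [(mem_honestIn.1 hp).1, (mem_honestIn.1 hq).1, if_true]
        exact hz1 p hp q hq
      · simp only [(mem_honestIn.1 hp).1, if_true]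
        exact hz2 w hw p hp
    · exact ⟨y, fun p hp => hy p hp, fun h => absurd h hsolves⟩
  obtain ⟨x, hres, hx⟩ := hinner
  obtain ⟨c, hres, hc⟩ := announce_spec (m := fun p => if p ∈ S' then some (true, x p) else none)
    hres
  refine ⟨fun p => if (o p).2 then (o p).1 else majority S' (c p) (o p).1, fun p hp => ?_,
    fun w hw p hp => ?_, fun hS' hgood' hsolves => ?_⟩
  · rw [show t + (r + 6) = t + 5 + r + 1 by omega]
    exact hres p hp
  · obtain ⟨h1, h2⟩ := ho.unanimous w hw p hp
    exact (if_pos h2).trans h1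
  · obtain ⟨hx1, hx2⟩ := hx hsolves
    have hmaj : ∀ w, (∀ p ∈ e.honestIn S', x p = w) → ∀ p ∈ e.honestIn S, ∀ y,
        majority S' (c p) y = w := by
      intro w hw p hp y
      refine majority_eq ?_ y
      have h1 : (e.honestIn S').card ≤ (announcers S' (c p) w).card :=
        Finset.card_le_card fun q hq => Finset.mem_filter.2 ⟨(mem_honestIn.1 hq).1, true, by
          rw [hc p hp q (hinc hq), if_pos (mem_honestIn.1 hq).1, hw q hq]⟩
      have h2 : (0 : ℝ) < ε * S'.card := mul_pos hε (by exact_mod_cast hS'.card_pos)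
      have h3 : (S'.card : ℝ) < 2 * (e.honestIn S').card := by
        unfold Good at hgood'
        linarith
      have h4 : S'.card < 2 * (e.honestIn S').card := by exact_mod_cast h3
      omega
    suffices ∃ w, ∀ p ∈ e.honestIn S,
        (if (o p).2 then (o p).1 else majority S' (c p) (o p).1) = w by
      obtain ⟨w, hw⟩ := this
      exact fun p hp q hq => (hw p hp).trans (hw q hq).symm
    by_cases hgr : ∃ p ∈ e.honestIn S, (o p).2
    · obtain ⟨p, hp, hgr⟩ := hgr
      have h1 := ho.consistent p hp hgr
      refine ⟨(o p).1, fun q hq => ?_⟩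
      split_ifs
      · exact h1 q hq
      · exact hmaj _ (hx2 _ fun r hr => h1 r (hinc hr)) q hq _
    · push Not at hgr
      have h2 : (0 : ℝ) < (e.honestIn S').card := by
        refine lt_of_lt_of_le ?_ hgood'
        have : (0 : ℝ) < S'.card := by exact_mod_cast hS'.card_pos
        positivity
      obtain ⟨r, hr⟩ := Finset.card_pos.1 (Nat.cast_pos.1 h2)
      refine ⟨x r, fun q hq => ?_⟩
      rw [if_neg (hgr q hq)]
      exact hmaj _ (fun p hp => hx1 p hp r hr) q hq _

end Execution

end Phases

/-! ### The recursion over dyadic blocks, and the final bounds. -/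

section Agreement

open Classical

variable {n ℓ : ℕ}

/-- The `a`-th block of `2 ^ k` consecutive parties. -/
def block (n k a : ℕ) : Finset (Fin n) := Finset.univ.filter fun p => p.1 / 2 ^ k = a

theorem mem_block {k a : ℕ} {p : Fin n} : p ∈ block n k a ↔ p.1 / 2 ^ k = a := by simp [block]

theorem card_block_le (n k a : ℕ) : (block n k a).card ≤ 2 ^ k := by
  have hpos : 0 < 2 ^ k := Nat.two_pow_pos k
  have : ((block n k a).image fun p => p.1 % 2 ^ k).card = (block n k a).card := by
    refine Finset.card_image_of_injOn fun p hp q hq h => Fin.ext ?_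
    have hp := mem_block.1 (Finset.mem_coe.1 hp)
    have hq := mem_block.1 (Finset.mem_coe.1 hq)
    rw [← Nat.div_add_mod p.1 (2 ^ k), ← Nat.div_add_mod q.1 (2 ^ k), hp, hq]
    exact congrArg _ h
  rw [← this]
  refine (Finset.card_le_card (t := Finset.range (2 ^ k)) fun x hx => ?_).trans (by simp)
  obtain ⟨p, -, rfl⟩ := Finset.mem_image.1 hx
  exact Finset.mem_range.2 (Nat.mod_lt _ hpos)

theorem block_succ (n k a : ℕ) :
    block n (k + 1) a = block n k (2 * a) ∪ block n k (2 * a + 1) := by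
  ext p
  rw [Finset.mem_union, mem_block, mem_block, mem_block, pow_succ, ← Nat.div_div_eq_div_mul]
  omega

theorem disjoint_block (n k a : ℕ) : Disjoint (block n k (2 * a)) (block n k (2 * a + 1)) :=
  Finset.disjoint_left.2 fun p h1 h2 => by
    rw [mem_block] at h1 h2
    omega

theorem block_zero_right {n k : ℕ} (h : n ≤ 2 ^ k) : block n k 0 = Finset.univ := by
  ext p
  simpa [mem_block] using lt_of_lt_of_le p.2 h

namespace Program

/-- The number of rounds of `Program.agree`. -/
def agreeLength : ℕ → ℕ
  | 0 => 0
  | k + 1 => (agreeLength k + 6) + (agreeLength k + 6)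

/-- Byzantine agreement among a block, with one phase for each half of the block. -/
noncomputable def agree (ε : ℝ) (N : Finset (Fin n) → Fin n → Finset (Fin n)) :
    ℕ → ℕ → Fin n → ℕ → Value ℓ → Program n (Value ℓ)
  | 0, _, _, _, v => pure v
  | k + 1, a, p, t, v =>
    let S := block n (k + 1) a
    (phase S (block n k (2 * a)) (N S p) ((1 / 2 + ε) * S.card) (agreeLength k) p
      (agree ε N k (2 * a) p) t v).bind fun w =>
        phase S (block n k (2 * a + 1)) (N S p) ((1 / 2 + ε) * S.card) (agreeLength k) p
          (agree ε N k (2 * a + 1) p) (t + (agreeLength k + 6)) w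

theorem hasLength_agree (ε : ℝ) (N : Finset (Fin n) → Fin n → Finset (Fin n)) (k a : ℕ)
    (p : Fin n) (t : ℕ) (v : Value ℓ) : (agree ε N k a p t v).HasLength (agreeLength k) := by
  induction k generalizing a t v with
  | zero => exact .pure v
  | succ k ih =>
    exact (hasLength_phase (fun t v => ih _ t v) _ _).bind fun _ =>
      hasLength_phase (fun t v => ih _ t v) _ _

/-- The two halves are disjoint, so a party pays for at most one recursive call. The recurrence `F
(k + 1) = F k + (4 * d + 8) * (c + 1) * κ * 2 ^ (k + 1)` gives a geometric sum, whence the factor `2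
* 2 ^ k`. -/
theorem costLE_agree {κ c d : ℕ} (hκ : 0 < κ) (ε : ℝ)
    {N : Finset (Fin n) → Fin n → Finset (Fin n)} (hN : ∀ S p, (N S p).card ≤ d) (k a : ℕ)
    (p : Fin n) (t : ℕ) (v : Value (c * κ)) :
    (agree ε N k a p t v).CostLE κ ((4 * d + 8) * ((c + 1) * κ * (2 * 2 ^ k))) := by
  induction k generalizing a t v with
  | zero => trivial
  | succ k ih =>
    refine CostLE.mono ((costLE_phase hκ (card_block_le n (k + 1) a) (hN _ p)
      (fun t v => ih _ t v) _ _).bind fun _ => costLE_phase hκ (card_block_le n (k + 1) a) (hN _ p)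
        (fun t v => ih _ t v) _ _) ?_
    have hdisj : ¬ (p ∈ block n k (2 * a) ∧ p ∈ block n k (2 * a + 1)) := fun h =>
      Finset.disjoint_left.1 (disjoint_block n k a) h.1 h.2
    have hpow : (4 * d + 8) * ((c + 1) * κ * (2 * 2 ^ (k + 1))) =
      (2 * d + 4) * ((c + 1) * κ * 2 ^ (k + 1)) + (2 * d + 4) * ((c + 1) * κ * 2 ^ (k + 1)) +
        (4 * d + 8) * ((c + 1) * κ * (2 * 2 ^ k)) := by ring
    rw [hpow]
    by_cases h1 : p ∈ block n k (2 * a) <;> by_cases h2 : p ∈ block n k (2 * a + 1)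
    · exact absurd ⟨h1, h2⟩ hdisj
    all_goals simp only [h1, h2, if_true, if_false]; omega

end Program

namespace Execution

open Program

variable {A : Fin n → Value ℓ → Program n (Value ℓ)} {e : Execution (Program.toProtocol A)}

/-- The honest fraction of the union is a weighted mean of those of the parts. Empty parts are
excluded because they are `Good` vacuously, and blocks can be empty when `n` is not a power of two.
-/
theorem Good.left_or_right {ε : ℝ} {S T : Finset (Fin n)} (hST : Disjoint S T)
    (hne : (S ∪ T).Nonempty) (h : e.Good ε (S ∪ T)) :
    (S.Nonempty ∧ e.Good ε S) ∨ (T.Nonempty ∧ e.Good ε T) := by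
  rcases S.eq_empty_or_nonempty with rfl | hS
  · rw [Finset.empty_union] at hne h
    exact Or.inr ⟨hne, h⟩
  rcases T.eq_empty_or_nonempty with rfl | hT
  · rw [Finset.union_empty] at hne h
    exact Or.inl ⟨hne, h⟩
  by_contra! hcon
  have h1 := hcon.1 hS
  have h2 := hcon.2 hT
  unfold Good at h h1 h2
  have h3 : (e.honestIn (S ∪ T)).card ≤ (e.honestIn S).card + (e.honestIn T).card := by
    unfold honestIn
    rw [Finset.filter_union]
    exact Finset.card_union_le _ _
  have h4 : ((e.honestIn (S ∪ T)).card : ℝ) ≤ (e.honestIn S).card + (e.honestIn T).card := by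
    exact_mod_cast h3
  rw [Finset.card_union_of_disjoint hST] at h
  push_cast at h
  linarith

theorem agree_spec {ε : ℝ} (hε : 0 < ε) {N : Finset (Fin n) → Fin n → Finset (Fin n)}
    (hN : ∀ S, S.Nonempty → IsExpander ε S (N S)) (k a : ℕ) (hne : (block n k a).Nonempty)
    (hgood : e.Good ε (block n k a)) :
    e.Solves (block n k a) (agreeLength k) (agree ε N k a) := by
  induction k generalizing a with
  -- A block of size `2 ^ 0` has at most one member.
  | zero =>
    intro t v K hres
    refine ⟨v, hres, fun p hp q hq => ?_, fun w hw p hp => hw p hp⟩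
    have h1 := mem_block.1 (mem_honestIn.1 hp).1
    have h2 := mem_block.1 (mem_honestIn.1 hq).1
    rw [pow_zero, Nat.div_one] at h1 h2
    rw [Fin.ext (h1.trans h2.symm)]
  | succ k ih =>
    intro t v K hres
    simp only [agree, Program.bind_assoc] at hres
    have hsub1 : block n k (2 * a) ⊆ block n (k + 1) a := by
      rw [block_succ]; exact Finset.subset_union_left
    have hsub2 : block n k (2 * a + 1) ⊆ block n (k + 1) a := by
      rw [block_succ]; exact Finset.subset_union_right
    obtain ⟨x, hres, hx, hx'⟩ := phase_spec hε hne hsub1 hgood (hN _ hne)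
      (fun p t v => hasLength_agree ε N k _ p t v) hres
    obtain ⟨y, hres, hy, hy'⟩ := phase_spec hε hne hsub2 hgood (hN _ hne)
      (fun p t v => hasLength_agree ε N k _ p t v) hres
    refine ⟨y, fun p hp => ?_, ?_, fun w hw => hy w (hx w hw)⟩
    · rw [agreeLength, ← add_assoc]; exact hres p hp
    · have h := hgood
      have hne' := hne
      rw [block_succ] at h hne'
      rcases h.left_or_right (disjoint_block n k a) hne' with ⟨h1, h2⟩ | ⟨h1, h2⟩
      -- The first half is good: agreement is reached in the first phase, and the second phase
      -- preserves it by unanimity.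
      · intro p hp q hq
        have hxq := fun r hr => hx' h1 h2 (ih _ h1 h2) r hr q hq
        rw [hy _ hxq p hp, hy _ hxq q hq]
      · exact hy' h1 h2 (ih _ h1 h2)

theorem decides_iff (p : Fin n) (v : Value ℓ) :
    e.Decides p v ↔ ∃ t, (e.residual p t).result = some v := Iff.rfl

theorem result_residual_of_le {p : Fin n} {v : Value ℓ} {t t' : ℕ} (h : t ≤ t')
    (hv : (e.residual p t).result = some v) : (e.residual p t').result = some v := by
  induction h with
  | refl => exact hv
  | step _ ih => exact (Program.toProtocol A).decide_final _ _ _ _ _ ih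

theorem eq_of_decides {p : Fin n} {v w : Value ℓ} (hv : e.Decides p v) (hw : e.Decides p w) :
    v = w := by
  obtain ⟨t, ht⟩ := (decides_iff p v).1 hv
  obtain ⟨t', ht'⟩ := (decides_iff p w).1 hw
  have h1 := result_residual_of_le (le_max_left t t') ht
  have h2 := result_residual_of_le (le_max_right t t') ht'
  exact Option.some_injective _ (h1.symm.trans h2)

theorem AtMostFaulty.good_univ {ε : ℝ} {f : ℕ} (h : e.AtMostFaulty f)
    (hf : (f : ℝ) ≤ (1 / 2 - ε) * n) : e.Good ε Finset.univ := by
  -- The bound on corruptions is stated round by round. By monotonicity, the latest of finitely many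
  -- corruption times captures all dishonest parties at once.
  have hcorrupt : ∀ p, ∃ t, ¬ e.Honest p → p ∈ e.corrupt t := fun p => by
    by_cases hp : e.Honest p
    · exact ⟨0, fun h => absurd hp h⟩
    · simp only [Honest, not_forall, not_not] at hp
      exact hp.imp fun t ht _ => ht
  choose τ hτ using hcorrupt
  have hsub : (Finset.univ.filter fun p => ¬ e.Honest p) ⊆
      e.corrupt (Finset.univ.sup τ) := fun p hp =>
    e.corrupt_mono (Finset.le_sup (Finset.mem_univ p)) (hτ p (Finset.mem_filter.1 hp).2)
  have h1 := (Finset.card_le_card hsub).trans (h _)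
  have h2 := Finset.card_filter_add_card_filter_not (s := (Finset.univ : Finset (Fin n))) e.Honest
  rw [Finset.card_univ, Fintype.card_fin] at h2
  have h3 : (n : ℝ) ≤ (e.honestIn Finset.univ).card + f := by
    have : n ≤ (e.honestIn Finset.univ).card + f := by unfold honestIn; omega
    exact_mod_cast this
  unfold Good
  rw [Finset.card_univ, Fintype.card_fin]
  linarith

end Execution

namespace Program

/-- The protocol in which all parties take part in `Program.agree`. -/
noncomputable def agreementProtocol (ε : ℝ) (n ℓ : ℕ)
    (N : Finset (Fin n) → Fin n → Finset (Fin n)) : Protocol n ℓ :=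
  toProtocol fun p x => (agree ε N (Nat.log 2 n + 1) 0 p 0 x).bind pure

theorem solvesBA_agreementProtocol {ε : ℝ} (hε : 0 < ε) {n ℓ : ℕ}
    {N : Finset (Fin n) → Fin n → Finset (Fin n)}
    (hN : ∀ S, S.Nonempty → IsExpander ε S (N S)) {f : ℕ} (hf : (f : ℝ) ≤ (1 / 2 - ε) * n) :
    (agreementProtocol ε n ℓ N).SolvesBA f := by
  intro e he
  have hblock : block n (Nat.log 2 n + 1) 0 = Finset.univ :=
    block_zero_right (Nat.lt_pow_succ_log_self (by norm_num) n).le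
  have main : ∃ out : Fin n → Value ℓ, (∀ p, e.Honest p → e.Decides p (out p)) ∧
      (∀ p q, e.Honest p → e.Honest q → out p = out q) ∧
        ∀ w, (∀ p, e.Honest p → e.input p = w) → ∀ p, e.Honest p → out p = w := by
    rcases Nat.eq_zero_or_pos n with rfl | hn
    · exact ⟨e.input, fun p => p.elim0, fun p => p.elim0, fun _ _ p => p.elim0⟩
    have hne : (block n (Nat.log 2 n + 1) 0).Nonempty := by
      rw [hblock]; exact ⟨⟨0, hn⟩, Finset.mem_univ _⟩
    have hgood : Execution.Good (e := e) ε (block n (Nat.log 2 n + 1) 0) := by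
      rw [hblock]; exact Execution.AtMostFaulty.good_univ he hf
    obtain ⟨out, h1, h2, h3⟩ := Execution.agree_spec hε hN _ 0 hne hgood 0 e.input
      (fun _ => pure) fun p _ => rfl
    have hmem : ∀ p, e.Honest p → p ∈ Execution.honestIn e (block n (Nat.log 2 n + 1) 0) :=
      fun p hp => Execution.mem_honestIn.2 ⟨by rw [hblock]; exact Finset.mem_univ p, hp⟩
    exact ⟨out, fun p hp => (Execution.decides_iff p _).2 ⟨_, by rw [h1 p (hmem p hp)]; rfl⟩,
      fun p q hp hq => h2 p (hmem p hp) q (hmem q hq),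
      fun w hw p hp => h3 w (fun q hq => hw q (Execution.mem_honestIn.1 hq).2) p (hmem p hp)⟩
  obtain ⟨out, h1, h2, h3⟩ := main
  refine ⟨fun p q v w hp hq hv hw => ?_, fun p hp => ⟨_, h1 p hp⟩, fun v hv p hp => ?_⟩
  · rw [Execution.eq_of_decides hv (h1 p hp), Execution.eq_of_decides hw (h1 q hq), h2 p q hp hq]
  · rw [← h3 v hv p hp]; exact h1 p hp

theorem communicationLE_agreementProtocol (ε : ℝ) {n κ c d : ℕ} (hκ : 0 < κ)
    {N : Finset (Fin n) → Fin n → Finset (Fin n)} (hN : ∀ S p, (N S p).card ≤ d) (f : ℕ) :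
    (agreementProtocol ε n (c * κ) N).CommunicationLE f κ
      (((4 * d + 8) * (c + 1) * 4 : ℕ) * κ * (n : ℝ) ^ 2) := by
  intro e _ T
  have h := Execution.bitsSent_le e (fun p x =>
    (costLE_agree hκ ε hN (Nat.log 2 n + 1) 0 p 0 x).bind fun v => costLE_pure κ v) T
  rw [Finset.sum_const, Finset.card_univ, Fintype.card_fin, smul_eq_mul] at h
  have h' : e.bitsSent κ T ≤ (4 * d + 8) * (c + 1) * 4 * κ * n ^ 2 := by
    rcases Nat.eq_zero_or_pos n with rfl | hn
    · exact h.trans (by simp)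
    refine h.trans ?_
    -- Rounding up to a power of two costs a factor 2, and the geometric sum another; together they
    -- give the 4 in the constant.
    have hpow : 2 ^ (Nat.log 2 n + 1) ≤ 2 * n := by
      rw [pow_succ, mul_comm]
      exact Nat.mul_le_mul_left 2 (Nat.pow_log_le_self 2 hn.ne')
    calc n * ((4 * d + 8) * ((c + 1) * κ * (2 * 2 ^ (Nat.log 2 n + 1))) + 0)
        ≤ n * ((4 * d + 8) * ((c + 1) * κ * (2 * (2 * n))) + 0) := by gcongr
      _ = (4 * d + 8) * (c + 1) * 4 * κ * n ^ 2 := by ring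
  exact_mod_cast h'

end Program

end Agreement

end ByzantineAgreement

theorem theorem2 (ε : ℝ) (hε : 0 < ε) (c : ℕ) :
    ∃ (C : ℝ) (P : (n κ : ℕ) → ByzantineAgreement.Protocol n (c * κ)),
      ∀ n κ : ℕ, 0 < κ → ∀ f : ℕ, (f : ℝ) ≤ (1 / 2 - ε) * n →
        (P n κ).SolvesBA f ∧ (P n κ).CommunicationLE f κ (C * κ * (n : ℝ) ^ 2) := by
  -- The expanders need a parameter below 1. Decreasing `ε` only admits more faults.
  have hε' : 0 < min ε (1 / 2) := lt_min hε (by norm_num)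
  obtain ⟨d, hd⟩ := ByzantineAgreement.exists_isExpander hε'
    ((min_le_right ε (1 / 2)).trans_lt (by norm_num))
  choose N hN using fun (n : ℕ) (S : Finset (Fin n)) => hd (Fin n) S
  refine ⟨((4 * d + 8) * (c + 1) * 4 : ℕ), fun n κ =>
    ByzantineAgreement.Program.agreementProtocol (min ε (1 / 2)) n (c * κ) (N n),
    fun n κ hκ f hf => ⟨?_, ?_⟩⟩
  · refine ByzantineAgreement.Program.solvesBA_agreementProtocol hε' (fun S => (hN n S).2)
      (hf.trans (mul_le_mul_of_nonneg_right ?_ n.cast_nonneg))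
    linarith [min_le_left ε (1 / 2)]
  · exact ByzantineAgreement.Program.communicationLE_agreementProtocol _ hκ
      (fun S => (hN n S).1) f
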